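/- Let $E$ be a Lusin topological space (a homeomorph of a Borel subset of a compact metric space), let $B(E)$ be the bounded Borel functions on $E$, $B(E)^+$ the nonnegative ones, and let $M(E)$ be the space of finite Borel measures on $E$ with the topology of weak convergence and its Borel $\sigma$-algebra; write $\mu(f)=\int_E f\,d\mu$ and $M(E)^\circ=M(E)\setminus\{0\}$. For a probability measure $P$ on $M(E)$ let $L_P(f)=\int_{M(E)}e^{-\nu(f)}P(d\nu)$, $f\in B(E)^+$; $P$ has finite first moment if $\int_{M(E)}\nu(1)P(d\nu)<\infty$. Let $(Q_t)_{t\ge0}$ be the transition semigroup of a measure-valued branching process on $M(E)$, i.e. a conservative transition semigroup on $M(E)$ such that, for $t\ge 0$, $\mu\in M(E)$, $f\in B(E)^+$, $$\int_{M(E)}e^{-\nu(f)}Q_t(\mu,d\nu)=e^{-\mu(V_tf)},\qquad V_tf(x)=-\log\int_{M(E)}e^{-\nu(f)}Q_t(\delta_x,d\nu).$$ Let $(K_t)_{t>0}$ be an infinitely divisible probability entrance law for $(Q_t)_{t\ge0}$, i.e. each $K_t$ is an infinitely divisible probability measure on $M(E)$ and $K_sQ_t=K_{s+t}$ for $s>0$,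 $t\ge0$. Put $I_s(K,f)=-\log L_{K_s}(f)$ and suppose that $s\mapsto I_s(K,f)$ is Lebesgue measurable on $(0,\infty)$ for every $f\in B(E)^+$ and that $\int_0^tI_s(K,1)\,ds<\infty$ for every $t\ge0$. Let $(N_t)_{t\ge0}$ be the skew convolution semigroup (SC-semigroup) associated with $(Q_t)_{t\ge 0}$ (probability measures on $M(E)$ with $N_{r+t}=(N_rQ_t)*N_t$ for $r,t\ge0$) that is given by $$L_{N_t}(f)=\exp\Big\{-\int_0^tI_s(K,f)\,ds\Big\},\qquad t\ge0,\ f\in B(E)^+.$$ Theorem 4.5. $N_t$ converges weakly as $t\to\infty$ to a probability measure $N_\infty$ on $M(E)$ with finite first moment if and only if $$\int_0^\infty ds\int_{M(E)}\nu(1)K_s(d\nu)<\infty.$$ In this case $$L_{N_\infty}(f)=\exp\Big\{-\int_0^\infty I_s(K,f)\,ds\Big\},\qquad f\in B(E)^+,$$ and $$\int_{M(E)^\circ}\nu(f)N_\infty(d\nu)=\int_0^\infty ds\int_{M(E)}\nu(f)K_s(d\nu),\qquad f\in B(E),$$ where all the integrals on the right-hand sides converge absolutely (the inner integral in the last formula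 being defined for almost every $s$). -/

import Mathlib

open MeasureTheory ProbabilityTheory Filter Topology Set
open scoped ENNReal NNReal BoundedContinuousFunction

/-- A Lusin topological space: a homeomorph of a Borel subset of a compact metric space. (Compact
metrizable spaces have at most the cardinality of the continuum, so letting `K` range over `Type`
loses nothing.) -/
class LusinSpace (E : Type*) [TopologicalSpace E] : Prop where
  exists_embedding : ∃ (K : Type) (_ : TopologicalSpace K) (_ : CompactSpace K)
    (_ : TopologicalSpace.MetrizableSpace K) (φ : E → K),
    IsEmbedding φ ∧ MeasurableSet[borel K] (range φ)

/-- A bounded continuous function on a subspace of a metric space is the pointwise limit from below of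
uniformly bounded continuous functions that extend to the whole space. -/
theorem exists_lipschitz_approx {E K : Type*} [TopologicalSpace E] [MetricSpace K]
    {φ : E → K} (hφ : IsEmbedding φ) (f : E →ᵇ ℝ) :
    ∃ g : ℕ → C(K, ℝ), (∀ k x, g k (φ x) ≤ f x) ∧ (∀ k x, -‖f‖ ≤ g k (φ x)) ∧
      ∀ x, Tendsto (fun k => g k (φ x)) atTop (𝓝 (f x)) := by
  rcases isEmpty_or_nonempty E with hE | hE
  · exact ⟨fun _ => 0, fun _ x => hE.elim x, fun _ x => hE.elim x, fun x => hE.elim x⟩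
  have hlow : ∀ y, -‖f‖ ≤ f y := fun y => (abs_le.1 (f.norm_coe_le_norm y)).1
  have hup : ∀ y, f y ≤ ‖f‖ := fun y => (abs_le.1 (f.norm_coe_le_norm y)).2
  have hbdd : ∀ (k : ℕ) (z : K), BddBelow (range fun y => f y + k * dist z (φ y)) := by
    intro k z
    refine ⟨-‖f‖, ?_⟩
    rintro _ ⟨y, rfl⟩
    have : 0 ≤ (k : ℝ) * dist z (φ y) := by positivity
    have := hlow y
    simp only
    linarith
  have hlip : ∀ k : ℕ, LipschitzWith k (fun z => ⨅ y, (f y + k * dist z (φ y))) := by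
    intro k
    refine LipschitzWith.of_le_add_mul _ fun z w => ?_
    rw [← sub_le_iff_le_add]
    refine le_ciInf fun y => ?_
    rw [sub_le_iff_le_add]
    refine (ciInf_le (hbdd k z) y).trans ?_
    have h1 : dist z (φ y) ≤ dist w (φ y) + dist z w := by
      linarith [dist_triangle z w (φ y)]
    have h2 := mul_le_mul_of_nonneg_left h1 (Nat.cast_nonneg (α := ℝ) k)
    simp only [NNReal.coe_natCast]
    linarith
  have hlef : ∀ (k : ℕ) (x : E), (⨅ y, (f y + k * dist (φ x) (φ y))) ≤ f x := by
    intro k x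
    simpa using ciInf_le (hbdd k (φ x)) x
  refine ⟨fun k => ⟨_, (hlip k).continuous⟩, hlef, ?_, ?_⟩
  · intro k x
    refine le_ciInf fun y => ?_
    have : 0 ≤ (k : ℝ) * dist (φ x) (φ y) := by positivity
    linarith [hlow y]
  · intro x
    refine tendsto_order.2 ⟨fun a ha => ?_, fun a ha =>
      Eventually.of_forall fun k => (hlef k x).trans_lt ha⟩
    obtain ⟨b, hab, hb⟩ := exists_between ha
    have hn : ∀ᶠ y in 𝓝 x, b < f y := f.continuous.continuousAt.eventually (lt_mem_nhds hb)
    rw [hφ.nhds_eq_comap, (Metric.nhds_basis_ball.comap φ).eventually_iff] at hn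
    obtain ⟨δ, hδ, hδ'⟩ := hn
    obtain ⟨k₀, hk₀⟩ := exists_nat_ge (2 * ‖f‖ / δ)
    filter_upwards [eventually_ge_atTop k₀] with k hk
    refine hab.trans_le (le_ciInf fun y => ?_)
    have hpos : 0 ≤ (k : ℝ) * dist (φ x) (φ y) := by positivity
    by_cases hy : dist (φ y) (φ x) < δ
    · have := hδ' (show y ∈ φ ⁻¹' Metric.ball (φ x) δ from hy)
      linarith
    · rw [not_lt, dist_comm] at hy
      have h1 : 2 * ‖f‖ ≤ k₀ * δ := by rwa [div_le_iff₀ hδ] at hk₀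
      have h2 : (k₀ : ℝ) * δ ≤ k * dist (φ x) (φ y) := by
        have : (k₀ : ℝ) ≤ k := by exact_mod_cast hk
        gcongr
      linarith [hlow y, hup x]

/-- Weakly open sets of finite measures belong to the σ-algebra generated by the evaluations. -/
theorem opensMeasurableSpace_finiteMeasure_of_isEmbedding {E K : Type*} [TopologicalSpace E]
    [MeasurableSpace E] [BorelSpace E] [MetricSpace K] [CompactSpace K]
    {φ : E → K} (hφ : IsEmbedding φ) : OpensMeasurableSpace (FiniteMeasure E) := by
  have hmeas : ∀ g : C(K, ℝ), Measurable fun x => g (φ x) := fun g =>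
    (g.continuous.comp hφ.continuous).measurable
  have hbd : ∀ (g : C(K, ℝ)) (x : E), ‖g (φ x)‖ ≤ ‖g‖ := fun g x => g.norm_coe_le_norm _
  have hint : ∀ (g : C(K, ℝ)) (μ : FiniteMeasure E), Integrable (fun x => g (φ x)) μ := fun g μ =>
    Integrable.of_bound (hmeas g).aestronglyMeasurable ‖g‖ (Eventually.of_forall (hbd g))
  let Φ : FiniteMeasure E → ℝ × (ℕ → ℝ) := fun μ =>
    ((μ : Measure E).real univ, fun n => ∫ x, TopologicalSpace.denseSeq C(K, ℝ) n (φ x) ∂μ)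
  have hind : ∀ μ : FiniteMeasure E, comap Φ (𝓝 (Φ μ)) ≤ 𝓝 μ := by
    intro μ
    set L := comap Φ (𝓝 (Φ μ)) with hL
    have hΦ : Tendsto Φ L (𝓝 (Φ μ)) := tendsto_comap
    have hmass : Tendsto (fun ν : FiniteMeasure E => (ν : Measure E).real univ) L
        (𝓝 ((μ : Measure E).real univ)) := (continuous_fst.tendsto _).comp hΦ
    have hseq : ∀ n, Tendsto
        (fun ν : FiniteMeasure E => ∫ x, TopologicalSpace.denseSeq C(K, ℝ) n (φ x) ∂ν) L
        (𝓝 (∫ x, TopologicalSpace.denseSeq C(K, ℝ) n (φ x) ∂μ)) := fun n =>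
      (((continuous_apply n).comp continuous_snd).tendsto _).comp hΦ
    have hC : ∀ g : C(K, ℝ), Tendsto (fun ν : FiniteMeasure E => ∫ x, g (φ x) ∂ν) L
        (𝓝 (∫ x, g (φ x) ∂μ)) := by
      intro g
      rw [Metric.tendsto_nhds]
      intro ε hε
      set m := (μ : Measure E).real univ with hm
      have hm0 : 0 ≤ m := measureReal_nonneg
      obtain ⟨n, hn⟩ := (TopologicalSpace.denseRange_denseSeq C(K, ℝ)).exists_dist_lt g
        (show 0 < ε / (3 * (m + 1)) by positivity)
      set h := TopologicalSpace.denseSeq C(K, ℝ) n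
      have hdiff : ∀ ν : FiniteMeasure E, (ν : Measure E).real univ < m + 1 →
          dist (∫ x, g (φ x) ∂ν) (∫ x, h (φ x) ∂ν) < ε / 3 := by
        intro ν hν
        rw [dist_eq_norm, ← integral_sub (hint g ν) (hint h ν)]
        have h1 : ‖∫ x, (g (φ x) - h (φ x)) ∂ν‖ ≤ dist g h * (ν : Measure E).real univ :=
          norm_integral_le_of_norm_le_const (Eventually.of_forall fun x => by
            rw [← dist_eq_norm]; exact ContinuousMap.dist_apply_le_dist _)
        have h2 : dist g h * (ν : Measure E).real univ ≤ dist g h * (m + 1) := by gcongr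
        have h3 : dist g h * (m + 1) < ε / (3 * (m + 1)) * (m + 1) := by gcongr
        have h4 : ε / (3 * (m + 1)) * (m + 1) = ε / 3 := by field_simp
        linarith
      filter_upwards [hmass.eventually (gt_mem_nhds (show m < m + 1 by linarith)),
        Metric.tendsto_nhds.1 (hseq n) (ε / 3) (by positivity)] with ν h1 h2
      have h3 := hdiff ν h1
      have h4 := hdiff μ (by linarith)
      rw [dist_comm] at h4
      have := dist_triangle4 (∫ x, g (φ x) ∂ν) (∫ x, h (φ x) ∂ν) (∫ x, h (φ x) ∂μ)
        (∫ x, g (φ x) ∂μ)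
      linarith
    have hfint : ∀ (f : E →ᵇ ℝ) (ν : FiniteMeasure E), Integrable f ν := fun f ν =>
      f.integrable ν
    have hlow : ∀ (f : E →ᵇ ℝ) (a : ℝ), a < ∫ x, f x ∂μ →
        ∀ᶠ ν : FiniteMeasure E in L, a < ∫ x, f x ∂ν := by
      intro f a ha
      obtain ⟨g, hg1, hg2, hg3⟩ := exists_lipschitz_approx hφ f
      have hlim : Tendsto (fun k => ∫ x, g k (φ x) ∂μ) atTop (𝓝 (∫ x, f x ∂μ)) := by
        refine tendsto_integral_of_dominated_convergence (fun _ => ‖f‖)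
          (fun k => (hmeas (g k)).aestronglyMeasurable) (integrable_const _)
          (fun k => Eventually.of_forall fun x => ?_) (Eventually.of_forall hg3)
        exact abs_le.2 ⟨hg2 k x, (hg1 k x).trans (abs_le.1 (f.norm_coe_le_norm x)).2⟩
      obtain ⟨k, hk⟩ := (hlim.eventually (lt_mem_nhds ha)).exists
      filter_upwards [(hC (g k)).eventually (lt_mem_nhds hk)] with ν hν
      exact hν.trans_le (integral_mono (hint _ _) (hfint _ _) (hg1 k))
    have : Tendsto id L (𝓝 μ) := by
      rw [FiniteMeasure.tendsto_iff_forall_integral_tendsto]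
      intro f
      refine tendsto_order.2 ⟨hlow f, fun a ha => ?_⟩
      have hneg := hlow (-f) (-a) (by simpa [integral_neg] using ha)
      filter_upwards [hneg] with ν hν
      simpa [integral_neg] using hν
    exact tendsto_id'.1 this
  have hΦm : Measurable Φ := by
    refine Measurable.prodMk ?_ (measurable_pi_lambda _ fun n => ?_)
    · exact ((Measure.measurable_coe MeasurableSet.univ).comp measurable_subtype_coe).ennreal_toReal
    · have hm := hmeas (TopologicalSpace.denseSeq C(K, ℝ) n)
      simp_rw [fun μ : FiniteMeasure E => integral_eq_lintegral_pos_part_sub_lintegral_neg_part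
        (hint (TopologicalSpace.denseSeq C(K, ℝ) n) μ)]
      exact ((Measure.measurable_lintegral hm.ennreal_ofReal).comp
        measurable_subtype_coe).ennreal_toReal.sub
        ((Measure.measurable_lintegral hm.neg.ennreal_ofReal).comp
        measurable_subtype_coe).ennreal_toReal
  refine ⟨?_⟩
  refine MeasurableSpace.generateFrom_le fun U hU => ?_
  have hU' : IsOpen U := hU
  have : U = Φ ⁻¹' (⋃₀ {V | IsOpen V ∧ Φ ⁻¹' V ⊆ U}) := by
    refine Subset.antisymm (fun μ hμ => ?_) ?_
    · have := hind μ (hU'.mem_nhds hμ)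
      obtain ⟨W, hW, hWU⟩ := mem_comap.1 this
      obtain ⟨V, hVW, hV, hμV⟩ := mem_nhds_iff.1 hW
      exact ⟨V, ⟨hV, (preimage_mono hVW).trans hWU⟩, hμV⟩
    · rintro μ ⟨V, ⟨_, hVU⟩, hμV⟩
      exact hVU hμV
  rw [this]
  exact hΦm (isOpen_sUnion fun V hV => hV.1).measurableSet

/-- On the space `M(E)` of finite Borel measures on a Lusin space `E`, Mathlib's σ-algebra (the one
generated by the evaluations `μ ↦ μ A`) is the Borel σ-algebra of the weak topology. -/
instance instBorelSpaceFiniteMeasure {E : Type*} [TopologicalSpace E] [LusinSpace E]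
    [MeasurableSpace E] [BorelSpace E] : BorelSpace (FiniteMeasure E) := by
  obtain ⟨K, _, _, _, φ, hφ, -⟩ := LusinSpace.exists_embedding (E := E)
  let _ : MetricSpace K := TopologicalSpace.metrizableSpaceMetric K
  have hO : OpensMeasurableSpace (FiniteMeasure E) :=
    opensMeasurableSpace_finiteMeasure_of_isEmbedding hφ
  have : TopologicalSpace.MetrizableSpace E := hφ.metrizableSpace
  refine ⟨le_antisymm ?_ hO.borel_le⟩
  have hval : Measurable[borel (FiniteMeasure E)] (fun μ : FiniteMeasure E => (μ : Measure E)) := by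
    borelize (FiniteMeasure E)
    have hgen : ‹MeasurableSpace E› = MeasurableSpace.generateFrom {s : Set E | IsClosed s} :=
      BorelSpace.measurable_eq.trans borel_eq_generateFrom_isClosed
    refine Measure.measurable_of_measurable_coe _ fun s hs => ?_
    induction s, hs using MeasurableSpace.induction_on_inter hgen isPiSystem_isClosed with
    | empty => simp
    | basic t ht =>
      have ht' : IsClosed t := ht
      exact measurable_of_tendsto_metrizable
        (fun n => (FiniteMeasure.continuous_lintegral_boundedContinuousFunction
          (ht'.apprSeq n)).measurable)
        (tendsto_pi_nhds.2 fun μ => HasOuterApproxClosed.tendsto_lintegral_apprSeq ht' μ)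
    | compl t ht ih =>
      have hu : Measurable fun μ : FiniteMeasure E => (μ : Measure E) univ := by
        simpa using (FiniteMeasure.continuous_lintegral_boundedContinuousFunction
          (1 : E →ᵇ ℝ≥0)).measurable
      simp_rw [fun μ : FiniteMeasure E => measure_compl ht (measure_ne_top (μ : Measure E) t)]
      exact hu.sub ih
    | iUnion f hd hf ih =>
      simp_rw [fun μ : FiniteMeasure E => measure_iUnion (μ := (μ : Measure E)) hd hf]
      exact Measurable.tsum ih
  rintro _ ⟨V, hV, rfl⟩
  exact hval hV

/-- `B(E)`: the bounded Borel functions on `E`. -/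
def BddBorel (E : Type*) [MeasurableSpace E] : Set (E → ℝ) :=
  {f | Measurable f ∧ ∃ C : ℝ, ∀ x, |f x| ≤ C}

/-- `B(E)⁺`: the nonnegative bounded Borel functions on `E`. -/
def BddBorelPos (E : Type*) [MeasurableSpace E] : Set (E → ℝ) :=
  {f | f ∈ BddBorel E ∧ ∀ x, 0 ≤ f x}

section MeasureValued

variable {E : Type*} [MeasurableSpace E]

/-- The Laplace functional `L_P(f) = ∫ e^{-ν(f)} P(dν)` of a measure `P` on `M(E)`. -/
noncomputable def laplaceFunctional (P : Measure (FiniteMeasure E)) (f : E → ℝ) : ℝ :=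
  ∫ ν : FiniteMeasure E, Real.exp (-∫ x, f x ∂(ν : Measure E)) ∂P

/-- The first moment `∫ ν(1) P(dν)` of a measure `P` on `M(E)`, as an element of `[0, ∞]`. -/
noncomputable def firstMoment (P : Measure (FiniteMeasure E)) : ℝ≥0∞ :=
  ∫⁻ ν : FiniteMeasure E, (ν : Measure E) univ ∂P

/-- The unit mass `δ_x` as an element of `M(E)`. -/
noncomputable def unitMass (x : E) : FiniteMeasure E := ⟨Measure.dirac x, inferInstance⟩

/-- `V_t f(x) = -log ∫ e^{-ν(f)} Q_t(δ_x, dν)`. -/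
noncomputable def cumulant (Q : ℝ → Kernel (FiniteMeasure E) (FiniteMeasure E)) (t : ℝ)
    (f : E → ℝ) (x : E) : ℝ :=
  -Real.log (laplaceFunctional (Q t (unitMass x)) f)

/-- `(Q_t)_{t ≥ 0}` is the transition semigroup of a measure-valued branching process: a
conservative transition semigroup on `M(E)` with the regular branching property
`∫ e^{-ν(f)} Q_t(μ, dν) = exp(-μ(V_t f))`. Only the values `Q t` with `0 ≤ t` matter. -/
structure IsMBSemigroup (Q : ℝ → Kernel (FiniteMeasure E) (FiniteMeasure E)) : Prop where
  markov : ∀ t, 0 ≤ t → IsMarkovKernel (Q t)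
  zero : Q 0 = Kernel.id
  add : ∀ s t, 0 ≤ s → 0 ≤ t → Q (s + t) = Q t ∘ₖ Q s
  branching : ∀ t, 0 ≤ t → ∀ μ : FiniteMeasure E, ∀ f ∈ BddBorelPos E,
    Integrable (cumulant Q t f) (μ : Measure E) ∧
      laplaceFunctional (Q t μ) f = Real.exp (-∫ x, cumulant Q t f x ∂(μ : Measure E))

/-- `(N_t)_{t ≥ 0}` is a skew convolution semigroup associated with `(Q_t)_{t ≥ 0}`:
`N_{r+t} = (N_r Q_t) * N_t`. Only the values `N t` with `0 ≤ t` matter. -/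
def IsSCSemigroup (Q : ℝ → Kernel (FiniteMeasure E) (FiniteMeasure E))
    (N : ℝ → ProbabilityMeasure (FiniteMeasure E)) : Prop :=
  ∀ r t, 0 ≤ r → 0 ≤ t →
    (N (r + t) : Measure (FiniteMeasure E)) =
      ((N r : Measure (FiniteMeasure E)).bind (Q t)).conv (N t : Measure (FiniteMeasure E))

/-- The `n`-fold convolution power of a measure on `M(E)`. -/
noncomputable def convPower (G : Measure (FiniteMeasure E)) : ℕ → Measure (FiniteMeasure E)
  | 0 => Measure.dirac 0
  | n + 1 => (convPower G n).conv G

/-- Infinite divisibility of a probability measure on `M(E)`. -/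
def IsInfDivisible (P : Measure (FiniteMeasure E)) : Prop :=
  ∀ n : ℕ, 1 ≤ n → ∃ G : Measure (FiniteMeasure E), IsProbabilityMeasure G ∧ P = convPower G n

/-- `(K_t)_{t > 0}` is an infinitely divisible probability entrance law for `(Q_t)_{t ≥ 0}`:
`K_s Q_t = K_{s+t}`, and every `K_t` is infinitely divisible. Only the values `K t` with `0 < t`
matter. -/
structure IsInfDivisibleEntranceLaw (Q : ℝ → Kernel (FiniteMeasure E) (FiniteMeasure E))
    (K : ℝ → ProbabilityMeasure (FiniteMeasure E)) : Prop where
  entrance : ∀ s t, 0 < s → 0 ≤ t →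
    (K s : Measure (FiniteMeasure E)).bind (Q t) = (K (s + t) : Measure (FiniteMeasure E))
  infDivisible : ∀ t, 0 < t → IsInfDivisible (K t : Measure (FiniteMeasure E))

/-- `I_s(K, f) = -log L_{K_s}(f)`. -/
noncomputable def logLaplace (K : ℝ → ProbabilityMeasure (FiniteMeasure E)) (s : ℝ)
    (f : E → ℝ) : ℝ :=
  -Real.log (laplaceFunctional (K s : Measure (FiniteMeasure E)) f)

/-- `(N_t)_{t ≥ 0}` is given by `(K_t)_{t > 0}` through
`L_{N_t}(f) = exp(-∫_0^t I_s(K, f) ds)`, where `∫_0^t I_s(K, 1) ds < ∞`. The first clause says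
that the integrands are (Lebesgue) measurable, so that the integrals have a meaning; as
`I_s(K, f) ≤ max(1, ‖f‖) I_s(K, 1)`, they are then all finite. -/
structure IsGivenByEntranceLaw (N K : ℝ → ProbabilityMeasure (FiniteMeasure E)) : Prop where
  measurable : ∀ f ∈ BddBorelPos E,
    AEMeasurable (fun s => logLaplace K s f) (volume.restrict (Ioi (0 : ℝ)))
  integrable : ∀ t : ℝ, 0 ≤ t → IntegrableOn (fun s => logLaplace K s (fun _ => 1)) (Ioc 0 t)
  laplace_eq : ∀ t : ℝ, 0 ≤ t → ∀ f ∈ BddBorelPos E,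
    laplaceFunctional (N t : Measure (FiniteMeasure E)) f =
      Real.exp (-∫ s in Ioc 0 t, logLaplace K s f)

end MeasureValued

/-! Everything rests on one identity in `[0, ∞]`: a weak limit `P` of `N_t` has first moment `∫_0^∞
ds ∫ ν(1) K_s(dν)`. It follows from the Laplace exponents. By Jensen, `2^k I(2^{-k} f)` increases
with `k`, and its limit is the mean of `ν(f)`. Monotone convergence therefore carries an identity of
exponents integrated over `s` to the same identity for means
(`lintegral_integral_eq_of_neg_log_laplaceFunctional_eq`). Constant `f` suffices for the total mass,
and constants are continuous, so weak convergence alone provides the exponent identity there. This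
gives one direction of the equivalence, and finiteness of the limit's moment in the other.

Existence of the limit comes from a coupling (`exists_tendsto_of_conv_of_firstMoment_le`). The skew
convolution property makes `N_t` a convolution of `N_s` with another law when `s ≤ t`, so `N_n` is
the law of a partial sum of independent random measures. Bounded first moments make the total mass
of the series integrable, hence almost surely finite, and the limit is the law of the sum. Between
integers the remainder has mean mass tending to zero.

The coupling also yields convergence of the Laplace functionals at every bounded Borel `f`, which
weak convergence does not give directly. Uniqueness of weak limits transfers this to any given
limit, and the moment identity for signed `f` follows by splitting into positive and negative parts.
-/

/-! ### Laplace exponents of a nonnegative random variable and its mean. -/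

section LaplaceTransform

variable {Ω : Type*} [MeasurableSpace Ω] {P : Measure Ω} [IsProbabilityMeasure P] {X : Ω → ℝ}

theorem integrable_exp_neg_of_nonneg (hX : Measurable X) (h0 : ∀ ω, 0 ≤ X ω) :
    Integrable (fun ω => Real.exp (-X ω)) P :=
  Integrable.of_bound hX.neg.exp.aestronglyMeasurable 1 (Eventually.of_forall fun ω => by
    rw [Real.norm_eq_abs, Real.abs_exp, Real.exp_le_one_iff]
    linarith [h0 ω])

theorem integral_exp_neg_pos (hX : Measurable X) (h0 : ∀ ω, 0 ≤ X ω) :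
    0 < ∫ ω, Real.exp (-X ω) ∂P :=
  integral_exp_pos (integrable_exp_neg_of_nonneg hX h0)

theorem integral_exp_neg_le_one (hX : Measurable X) (h0 : ∀ ω, 0 ≤ X ω) :
    ∫ ω, Real.exp (-X ω) ∂P ≤ 1 := by
  have := integral_mono (integrable_exp_neg_of_nonneg (P := P) hX h0) (integrable_const (1 : ℝ))
    (fun ω => Real.exp_le_one_iff.2 (by linarith [h0 ω]))
  simpa using this

/-- `-log E[e^{-2X}] ≤ 2 (-log E[e^{-X}])`. -/
theorem neg_log_integral_exp_two_mul_le (hX : Measurable X) (h0 : ∀ ω, 0 ≤ X ω) :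
    -Real.log (∫ ω, Real.exp (-(2 * X ω)) ∂P) ≤ 2 * -Real.log (∫ ω, Real.exp (-X ω) ∂P) := by
  have hsq : ∀ ω, Real.exp (-X ω) ^ 2 = Real.exp (-(2 * X ω)) := fun ω => by
    rw [← Real.exp_nat_mul]; congr 1; push_cast; ring
  have h2 : Integrable (fun ω => Real.exp (-(2 * X ω))) P :=
    integrable_exp_neg_of_nonneg (hX.const_mul 2) fun ω => mul_nonneg zero_le_two (h0 ω)
  -- Jensen for the square: `E[e^{-X}]² ≤ E[e^{-2X}]`.
  have h := (Even.convexOn_pow (𝕜 := ℝ) even_two).map_integral_le (μ := P)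
    (continuous_pow 2).continuousOn isClosed_univ (Eventually.of_forall fun _ => mem_univ _)
    (integrable_exp_neg_of_nonneg hX h0) (h2.congr (Eventually.of_forall fun ω => (hsq ω).symm))
  simp only [hsq] at h
  have h3 := Real.log_le_log (pow_pos (integral_exp_neg_pos hX h0) 2) h
  rw [Real.log_pow] at h3
  push_cast at h3
  linarith

/-- `θ⁻¹ (-log E[e^{-θX}])` tends to `E[X]` as `θ = 2⁻ᵏ` tends to `0`. -/
theorem tendsto_two_pow_mul_neg_log_integral_exp (hX : Measurable X) (h0 : ∀ ω, 0 ≤ X ω) :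
    Tendsto (fun k : ℕ => (2 : ℝ≥0∞) ^ k *
      ENNReal.ofReal (-Real.log (∫ ω, Real.exp (-((1 / 2) ^ k * X ω)) ∂P))) atTop
      (𝓝 (∫⁻ ω, ENNReal.ofReal (X ω) ∂P)) := by
  have hXk : ∀ k : ℕ, Measurable fun ω => (1 / 2 : ℝ) ^ k * X ω := fun k => hX.const_mul _
  have h0k : ∀ (k : ℕ) ω, 0 ≤ (1 / 2 : ℝ) ^ k * X ω := fun k ω => mul_nonneg (by positivity) (h0 ω)
  set L : ℕ → ℝ := fun k => ∫ ω, Real.exp (-((1 / 2) ^ k * X ω)) ∂P with hL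
  have hLpos : ∀ k, 0 < L k := fun k => integral_exp_neg_pos (hXk k) (h0k k)
  have hLone : ∀ k, L k ≤ 1 := fun k => integral_exp_neg_le_one (hXk k) (h0k k)
  have hpow : Tendsto (fun k : ℕ => (1 / 2 : ℝ) ^ k) atTop (𝓝 0) :=
    tendsto_pow_atTop_nhds_zero_of_lt_one (by norm_num) (by norm_num)
  have hexp : ∀ ω, Tendsto (fun k : ℕ => Real.exp (-((1 / 2) ^ k * X ω))) atTop (𝓝 1) := by
    intro ω
    have := ((hpow.mul_const (X ω)).neg).rexp
    simpa using this
  have hLlim : Tendsto L atTop (𝓝 1) := by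
    have := tendsto_integral_of_dominated_convergence (μ := P) (fun _ => (1 : ℝ))
      (F := fun (k : ℕ) ω => Real.exp (-((1 / 2) ^ k * X ω))) (f := fun _ => 1)
      (fun k => (hXk k).neg.exp.aestronglyMeasurable) (integrable_const _)
      (fun k => Eventually.of_forall fun ω => by
        rw [Real.norm_eq_abs, Real.abs_exp, Real.exp_le_one_iff]
        linarith [h0k k ω]) (Eventually.of_forall hexp)
    simpa [hL] using this
  have h2k : ∀ k : ℕ, (2 : ℝ≥0∞) ^ k = ENNReal.ofReal (2 ^ k) := fun k => by
    rw [ENNReal.ofReal_pow zero_le_two]; simp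
  have hlow_eq : ∀ k, (2 : ℝ≥0∞) ^ k * ENNReal.ofReal (1 - L k) =
      ∫⁻ ω, ENNReal.ofReal (2 ^ k * (1 - Real.exp (-((1 / 2) ^ k * X ω)))) ∂P := by
    intro k
    have hi := integrable_exp_neg_of_nonneg (P := P) (hXk k) (h0k k)
    have hs : Integrable (fun ω => (2 : ℝ) ^ k * (1 - Real.exp (-((1 / 2) ^ k * X ω)))) P :=
      ((integrable_const 1).sub hi).const_mul _
    rw [h2k, ← ENNReal.ofReal_mul (by positivity), ← ofReal_integral_eq_lintegral_ofReal hs,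
      integral_const_mul,
      integral_sub (integrable_const _) hi]
    · simp [hL]
    · exact Eventually.of_forall fun ω => mul_nonneg (by positivity)
        (sub_nonneg.2 (Real.exp_le_one_iff.2 (by linarith [h0k k ω])))
  have hlow : Tendsto (fun k : ℕ => (2 : ℝ≥0∞) ^ k * ENNReal.ofReal (1 - L k)) atTop
      (𝓝 (∫⁻ ω, ENNReal.ofReal (X ω) ∂P)) := by
    simp_rw [hlow_eq]
    refine lintegral_tendsto_of_tendsto_of_monotone
      (fun k => (((hXk k).neg.exp.const_sub 1).const_mul _).ennreal_ofReal.aemeasurable)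
      (Eventually.of_forall fun ω => monotone_nat_of_le_succ fun k => ?_)
      (Eventually.of_forall fun ω => ENNReal.tendsto_ofReal ?_)
    · refine ENNReal.ofReal_le_ofReal ?_
      -- With `e = exp(-2^{-(k+1)} X)`, monotonicity reads `1 - e² ≤ 2(1 - e)`, that is `(1 - e)² ≥
      -- 0`.
      have h1 : Real.exp (-((1 / 2) ^ k * X ω)) = Real.exp (-((1 / 2) ^ (k + 1) * X ω)) ^ 2 := by
        rw [← Real.exp_nat_mul]; congr 1; push_cast; ring
      rw [h1, pow_succ (2 : ℝ) k, mul_assoc]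
      gcongr
      nlinarith [sq_nonneg (1 - Real.exp (-((1 / 2) ^ (k + 1) * X ω)))]
    -- Squeeze from `y e^{-y} ≤ 1 - e^{-y} ≤ y` at `y = 2^{-k} X`.
    · have h1 : Tendsto (fun k : ℕ => X ω * Real.exp (-((1 / 2) ^ k * X ω))) atTop (𝓝 (X ω)) := by
        simpa using (hexp ω).const_mul (X ω)
      have h2 : ∀ k : ℕ, (2 : ℝ) ^ k * ((1 / 2) ^ k * X ω) = X ω := fun k => by
        rw [← mul_assoc, ← mul_pow]; norm_num
      refine tendsto_of_tendsto_of_tendsto_of_le_of_le h1 tendsto_const_nhds (fun k => ?_)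
        fun k => ?_
      · set y := (1 / 2 : ℝ) ^ k * X ω with hy
        have h3 : y * Real.exp (-y) ≤ 1 - Real.exp (-y) := by
          have h4 := mul_le_mul_of_nonneg_right (Real.add_one_le_exp y) (Real.exp_pos (-y)).le
          rw [← Real.exp_add, add_neg_cancel, Real.exp_zero] at h4
          linarith
        calc X ω * Real.exp (-y) = 2 ^ k * (y * Real.exp (-y)) := by rw [← mul_assoc, h2]
          _ ≤ _ := by gcongr
      · set y := (1 / 2 : ℝ) ^ k * X ω with hy
        calc (2 : ℝ) ^ k * (1 - Real.exp (-y)) ≤ 2 ^ k * y := by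
              gcongr; linarith [Real.add_one_le_exp (-y)]
          _ = X ω := h2 k
  have hup : Tendsto (fun k : ℕ => (2 : ℝ≥0∞) ^ k * ENNReal.ofReal (1 - L k) *
      ENNReal.ofReal (L k)⁻¹) atTop (𝓝 (∫⁻ ω, ENNReal.ofReal (X ω) ∂P)) := by
    have h1 : Tendsto (fun k => ENNReal.ofReal (L k)⁻¹) atTop (𝓝 1) := by
      simpa using ENNReal.tendsto_ofReal (hLlim.inv₀ one_ne_zero)
    simpa using ENNReal.Tendsto.mul hlow (Or.inr ENNReal.one_ne_top) h1 (Or.inl one_ne_zero)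
  -- The logarithm is trapped by `1 - L ≤ -log L ≤ (1 - L)/L`, and `L → 1`.
  refine tendsto_of_tendsto_of_tendsto_of_le_of_le hlow hup (fun k => ?_) fun k => ?_
  · dsimp only
    gcongr
    linarith [Real.log_le_sub_one_of_pos (hLpos k)]
  · dsimp only
    rw [mul_assoc, ← ENNReal.ofReal_mul (by linarith [hLone k])]
    gcongr
    have := Real.log_le_sub_one_of_pos (inv_pos.2 (hLpos k))
    rw [Real.log_inv] at this
    rwa [sub_mul, mul_inv_cancel₀ (hLpos k).ne', one_mul]

end LaplaceTransform

/-! ### Laplace functionals of random measures. -/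

section LaplaceFunctional

variable {E : Type*} [MeasurableSpace E]

theorem measurable_integral_finiteMeasure {f : E → ℝ} (hf : Measurable f) :
    Measurable fun ν : FiniteMeasure E => ∫ x, f x ∂(ν : Measure E) :=
  (hf.stronglyMeasurable.integral_kernel
    (κ := ⟨fun ν : FiniteMeasure E => (ν : Measure E), measurable_subtype_coe⟩)).measurable

theorem integrable_of_mem_bddBorel {f : E → ℝ} (hf : f ∈ BddBorel E) (ν : Measure E)
    [IsFiniteMeasure ν] : Integrable f ν := by
  obtain ⟨hm, C, hC⟩ := hf
  exact Integrable.of_bound hm.aestronglyMeasurable C (Eventually.of_forall hC)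

theorem const_mul_mem_bddBorelPos {f : E → ℝ} (hf : f ∈ BddBorelPos E) {c : ℝ} (hc : 0 ≤ c) :
    (fun x => c * f x) ∈ BddBorelPos E := by
  obtain ⟨⟨hm, C, hC⟩, h0⟩ := hf
  refine ⟨⟨hm.const_mul c, c * C, fun x => ?_⟩, fun x => mul_nonneg hc (h0 x)⟩
  rw [abs_mul, abs_of_nonneg hc]
  exact mul_le_mul_of_nonneg_left (hC x) hc

theorem const_mem_bddBorelPos {c : ℝ} (hc : 0 ≤ c) : (fun _ : E => c) ∈ BddBorelPos E :=
  ⟨⟨measurable_const, |c|, fun _ => le_rfl⟩, fun _ => hc⟩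

theorem laplaceFunctional_const_mul (P : Measure (FiniteMeasure E)) (c : ℝ) (f : E → ℝ) :
    laplaceFunctional P (fun x => c * f x) =
      ∫ ν : FiniteMeasure E, Real.exp (-(c * ∫ x, f x ∂(ν : Measure E))) ∂P := by
  simp only [laplaceFunctional, integral_const_mul]

theorem firstMoment_eq_lintegral_ofReal (P : Measure (FiniteMeasure E)) :
    firstMoment P =
      ∫⁻ ν : FiniteMeasure E, ENNReal.ofReal (∫ _, (1 : ℝ) ∂(ν : Measure E)) ∂P := by
  simp [firstMoment, measureReal_def]

variable {P : Measure (FiniteMeasure E)} [IsProbabilityMeasure P]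

theorem laplaceFunctional_pos {f : E → ℝ} (hf : f ∈ BddBorelPos E) :
    0 < laplaceFunctional P f :=
  integral_exp_neg_pos (measurable_integral_finiteMeasure hf.1.1) fun _ => integral_nonneg hf.2

theorem laplaceFunctional_le_one {f : E → ℝ} (hf : f ∈ BddBorelPos E) :
    laplaceFunctional P f ≤ 1 :=
  integral_exp_neg_le_one (measurable_integral_finiteMeasure hf.1.1) fun _ => integral_nonneg hf.2

theorem neg_log_laplaceFunctional_nonneg {f : E → ℝ} (hf : f ∈ BddBorelPos E) :
    0 ≤ -Real.log (laplaceFunctional P f) :=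
  neg_nonneg.2 (Real.log_nonpos (laplaceFunctional_pos hf).le (laplaceFunctional_le_one hf))

theorem neg_log_laplaceFunctional_mono {f g : E → ℝ} (hf : f ∈ BddBorelPos E)
    (hg : g ∈ BddBorelPos E) (hfg : ∀ x, f x ≤ g x) :
    -Real.log (laplaceFunctional P f) ≤ -Real.log (laplaceFunctional P g) := by
  refine neg_le_neg (Real.log_le_log (laplaceFunctional_pos hg) ?_)
  refine integral_mono
    (integrable_exp_neg_of_nonneg (measurable_integral_finiteMeasure hg.1.1)
      fun _ => integral_nonneg hg.2)
    (integrable_exp_neg_of_nonneg (measurable_integral_finiteMeasure hf.1.1)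
      fun _ => integral_nonneg hf.2) fun ν => ?_
  exact Real.exp_le_exp.2 (neg_le_neg (integral_mono (integrable_of_mem_bddBorel hf.1 _)
    (integrable_of_mem_bddBorel hg.1 _) hfg))

theorem neg_log_laplaceFunctional_two_mul_le {f : E → ℝ} (hf : f ∈ BddBorelPos E) :
    -Real.log (laplaceFunctional P fun x => 2 * f x) ≤
      2 * -Real.log (laplaceFunctional P f) := by
  rw [laplaceFunctional_const_mul]
  exact neg_log_integral_exp_two_mul_le (measurable_integral_finiteMeasure hf.1.1)
    fun _ => integral_nonneg hf.2

/-- Iterated doubling. With monotonicity in `f` it bounds every exponent by a multiple of the one at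
`1`. -/
theorem neg_log_laplaceFunctional_two_pow_mul_le {f : E → ℝ} (hf : f ∈ BddBorelPos E) (k : ℕ) :
    -Real.log (laplaceFunctional P fun x => 2 ^ k * f x) ≤
      2 ^ k * -Real.log (laplaceFunctional P f) := by
  induction k with
  | zero => simp
  | succ k ih =>
    have h := neg_log_laplaceFunctional_two_mul_le (P := P)
      (const_mul_mem_bddBorelPos hf (show (0 : ℝ) ≤ 2 ^ k by positivity))
    simp only [← mul_assoc, ← pow_succ'] at h
    rw [pow_succ' (2 : ℝ) k] at h ⊢
    linarith

/-- Doubling applied to `2^{-(k+1)} f`. The monotonicity permits monotone convergence under the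
integral over `s`, with no integrability assumed. -/
theorem monotone_two_pow_mul_neg_log_laplaceFunctional {f : E → ℝ} (hf : f ∈ BddBorelPos E) :
    Monotone fun k : ℕ => (2 : ℝ≥0∞) ^ k *
      ENNReal.ofReal (-Real.log (laplaceFunctional P fun x => (1 / 2) ^ k * f x)) := by
  refine monotone_nat_of_le_succ fun k => ?_
  have h := neg_log_laplaceFunctional_two_mul_le (P := P)
    (const_mul_mem_bddBorelPos hf (show (0 : ℝ) ≤ (1 / 2) ^ (k + 1) by positivity))
  have h2 : (2 : ℝ) * (1 / 2) ^ (k + 1) = (1 / 2) ^ k := by rw [pow_succ]; ring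
  simp only [← mul_assoc, h2] at h
  rw [pow_succ, mul_assoc]
  gcongr
  rw [show (2 : ℝ≥0∞) = ENNReal.ofReal 2 by simp, ← ENNReal.ofReal_mul zero_le_two]
  exact ENNReal.ofReal_le_ofReal h

theorem tendsto_two_pow_mul_neg_log_laplaceFunctional {f : E → ℝ} (hf : f ∈ BddBorelPos E) :
    Tendsto (fun k : ℕ => (2 : ℝ≥0∞) ^ k *
      ENNReal.ofReal (-Real.log (laplaceFunctional P fun x => (1 / 2) ^ k * f x))) atTop
      (𝓝 (∫⁻ ν : FiniteMeasure E, ENNReal.ofReal (∫ x, f x ∂(ν : Measure E)) ∂P)) := by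
  simp only [laplaceFunctional_const_mul]
  exact tendsto_two_pow_mul_neg_log_integral_exp (measurable_integral_finiteMeasure hf.1.1)
    fun _ => integral_nonneg hf.2

end LaplaceFunctional

/-! ### Integrating exponents and first moments over the entrance law. -/

section LogLaplace

variable {E : Type*} [MeasurableSpace E] {K : ℝ → ProbabilityMeasure (FiniteMeasure E)}

theorem logLaplace_nonneg (s : ℝ) {f : E → ℝ} (hf : f ∈ BddBorelPos E) : 0 ≤ logLaplace K s f :=
  neg_log_laplaceFunctional_nonneg hf

/-- The first moments of `K` are measurable, as limits of rescaled Laplace exponents. -/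
theorem aemeasurable_lintegral_integral {A : Set ℝ}
    (hK : ∀ f ∈ BddBorelPos E, AEMeasurable (fun s => logLaplace K s f) (volume.restrict A))
    {f : E → ℝ} (hf : f ∈ BddBorelPos E) :
    AEMeasurable (fun s => ∫⁻ ν : FiniteMeasure E, ENNReal.ofReal (∫ x, f x ∂(ν : Measure E))
      ∂(K s : Measure (FiniteMeasure E))) (volume.restrict A) :=
  aemeasurable_of_tendsto_metrizable_ae' (fun k : ℕ =>
    ((hK _ (const_mul_mem_bddBorelPos hf (show (0 : ℝ) ≤ (1 / 2) ^ k by positivity))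
      ).ennreal_ofReal).const_mul ((2 : ℝ≥0∞) ^ k))
    (Eventually.of_forall fun _ => tendsto_two_pow_mul_neg_log_laplaceFunctional hf)

/-- If the Laplace exponent of `P` is the integral over `A` of those of `K`, then the first moment of
`P` is the integral over `A` of those of `K`. -/
theorem lintegral_integral_eq_of_neg_log_laplaceFunctional_eq {A : Set ℝ}
    (hK : ∀ f ∈ BddBorelPos E, AEMeasurable (fun s => logLaplace K s f) (volume.restrict A))
    {P : Measure (FiniteMeasure E)} [IsProbabilityMeasure P] {f : E → ℝ} (hf : f ∈ BddBorelPos E)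
    (h : ∀ c : ℝ, 0 ≤ c → ENNReal.ofReal (-Real.log (laplaceFunctional P fun x => c * f x)) =
      ∫⁻ s in A, ENNReal.ofReal (logLaplace K s fun x => c * f x)) :
    ∫⁻ ν : FiniteMeasure E, ENNReal.ofReal (∫ x, f x ∂(ν : Measure E)) ∂P =
      ∫⁻ s in A, ∫⁻ ν : FiniteMeasure E, ENNReal.ofReal (∫ x, f x ∂(ν : Measure E))
        ∂(K s : Measure (FiniteMeasure E)) := by
  refine tendsto_nhds_unique (tendsto_two_pow_mul_neg_log_laplaceFunctional (P := P) hf) ?_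
  have hmeas : ∀ k : ℕ, AEMeasurable (fun s => ENNReal.ofReal
      (logLaplace K s fun x => (1 / 2) ^ k * f x)) (volume.restrict A) := fun k =>
    (hK _ (const_mul_mem_bddBorelPos hf (by positivity))).ennreal_ofReal
  have heq : ∀ k : ℕ, (2 : ℝ≥0∞) ^ k *
      ENNReal.ofReal (-Real.log (laplaceFunctional P fun x => (1 / 2) ^ k * f x)) =
      ∫⁻ s in A, (2 : ℝ≥0∞) ^ k * ENNReal.ofReal (logLaplace K s fun x => (1 / 2) ^ k * f x) :=
    fun k => by rw [h _ (by positivity), lintegral_const_mul'' _ (hmeas k)]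
  simp only [heq]
  exact lintegral_tendsto_of_tendsto_of_monotone (fun k => (hmeas k).const_mul _)
    (Eventually.of_forall fun _ => monotone_two_pow_mul_neg_log_laplaceFunctional hf)
    (Eventually.of_forall fun _ => tendsto_two_pow_mul_neg_log_laplaceFunctional hf)

variable {N : ℝ → ProbabilityMeasure (FiniteMeasure E)}

theorem IsGivenByEntranceLaw.integrableOn (hNK : IsGivenByEntranceLaw N K) {t : ℝ} (ht : 0 ≤ t)
    {f : E → ℝ} (hf : f ∈ BddBorelPos E) :
    IntegrableOn (fun s => logLaplace K s f) (Ioc 0 t) := by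
  obtain ⟨C, hC⟩ := hf.1.2
  -- From `f ≤ C < 2^k` one gets `I_s(K, f) ≤ 2^k I_s(K, 1)`, an integrable bound on `(0, t]`.
  obtain ⟨k, hk⟩ := pow_unbounded_of_one_lt C (one_lt_two (α := ℝ))
  refine ((hNK.integrable t ht).const_mul (2 ^ k)).mono'
    ((hNK.measurable f hf).mono_measure
      (Measure.restrict_mono Ioc_subset_Ioi_self le_rfl)).aestronglyMeasurable
    (Eventually.of_forall fun s => ?_)
  rw [Real.norm_of_nonneg (logLaplace_nonneg s hf)]
  have h1 := const_mem_bddBorelPos (E := E) zero_le_one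
  refine (neg_log_laplaceFunctional_mono hf (const_mul_mem_bddBorelPos h1
    (show (0 : ℝ) ≤ 2 ^ k by positivity)) fun x => ?_).trans
    (neg_log_laplaceFunctional_two_pow_mul_le h1 k)
  linarith [le_abs_self (f x), hC x]

theorem IsGivenByEntranceLaw.ofReal_neg_log_laplaceFunctional (hNK : IsGivenByEntranceLaw N K)
    {t : ℝ} (ht : 0 ≤ t) {f : E → ℝ} (hf : f ∈ BddBorelPos E) :
    ENNReal.ofReal (-Real.log (laplaceFunctional (N t : Measure (FiniteMeasure E)) f)) =
      ∫⁻ s in Ioc 0 t, ENNReal.ofReal (logLaplace K s f) := by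
  rw [hNK.laplace_eq t ht f hf, Real.log_exp, neg_neg]
  exact ofReal_integral_eq_lintegral_ofReal (hNK.integrableOn ht hf)
    (Eventually.of_forall fun s => logLaplace_nonneg s hf)

/-- The sets `(0, n]` exhaust `(0, ∞)` and the integrand is nonnegative. Convergence is assumed for
the single `f`, so the lemma serves both constants under weak convergence and Borel `f` under the
coupling. -/
theorem IsGivenByEntranceLaw.ofReal_neg_log_laplaceFunctional_of_tendsto
    (hNK : IsGivenByEntranceLaw N K) {P : Measure (FiniteMeasure E)} [IsProbabilityMeasure P]
    {f : E → ℝ} (hf : f ∈ BddBorelPos E)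
    (h : Tendsto (fun n : ℕ => laplaceFunctional (N n : Measure (FiniteMeasure E)) f) atTop
      (𝓝 (laplaceFunctional P f))) :
    ENNReal.ofReal (-Real.log (laplaceFunctional P f)) =
      ∫⁻ s in Ioi 0, ENNReal.ofReal (logLaplace K s f) := by
  have h1 := ENNReal.tendsto_ofReal (h.log (laplaceFunctional_pos hf).ne').neg
  simp only [hNK.ofReal_neg_log_laplaceFunctional (Nat.cast_nonneg _) hf] at h1
  have h2 := ((aecover_Iic tendsto_natCast_atTop_atTop).lintegral_tendsto_of_countably_generated
    (hNK.measurable f hf).ennreal_ofReal)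
  simp only [Measure.restrict_restrict measurableSet_Iic, inter_comm (Iic _), Ioi_inter_Iic] at h2
  exact tendsto_nhds_unique h1 h2

theorem IsGivenByEntranceLaw.firstMoment_eq (hNK : IsGivenByEntranceLaw N K) {t : ℝ} (ht : 0 ≤ t) :
    firstMoment (N t : Measure (FiniteMeasure E)) =
      ∫⁻ s in Ioc 0 t, firstMoment (K s : Measure (FiniteMeasure E)) := by
  simp only [firstMoment_eq_lintegral_ofReal]
  have h1 := const_mem_bddBorelPos (E := E) zero_le_one
  exact lintegral_integral_eq_of_neg_log_laplaceFunctional_eq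
    (fun f hf => (hNK.measurable f hf).mono_measure
      (Measure.restrict_mono Ioc_subset_Ioi_self le_rfl)) h1
    fun c hc => hNK.ofReal_neg_log_laplaceFunctional ht (const_mul_mem_bddBorelPos h1 hc)

end LogLaplace

/-! ### Measurability of addition on `M(E)`, and additivity of first moments. -/

section Measurability

variable {E α : Type*} [MeasurableSpace E] [MeasurableSpace α]

theorem measurable_finiteMeasure_of_measurable_coe {f : α → FiniteMeasure E}
    (h : ∀ s, MeasurableSet s → Measurable fun a => (f a : Measure E) s) : Measurable f :=
  (Measure.measurable_of_measurable_coe (fun a => (f a : Measure E)) h).subtype_mk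

theorem measurable_finiteMeasure_coe {s : Set E} (hs : MeasurableSet s) :
    Measurable fun ν : FiniteMeasure E => (ν : Measure E) s :=
  (Measure.measurable_coe hs).comp measurable_subtype_coe

instance instMeasurableAddFiniteMeasure : MeasurableAdd₂ (FiniteMeasure E) where
  measurable_add := measurable_finiteMeasure_of_measurable_coe fun s hs => by
    simp only [FiniteMeasure.toMeasure_add, Measure.add_apply]
    exact ((measurable_finiteMeasure_coe hs).comp measurable_fst).add
      ((measurable_finiteMeasure_coe hs).comp measurable_snd)

theorem firstMoment_conv (P R : Measure (FiniteMeasure E)) [IsProbabilityMeasure P]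
    [IsProbabilityMeasure R] : firstMoment (P.conv R) = firstMoment P + firstMoment R := by
  have hm := measurable_finiteMeasure_coe (E := E) MeasurableSet.univ
  simp only [firstMoment]
  rw [Measure.lintegral_conv hm]
  simp only [FiniteMeasure.toMeasure_add, Measure.add_apply]
  simp_rw [lintegral_add_right _ hm, lintegral_const, measure_univ, mul_one]
  rw [lintegral_add_left hm]
  simp

end Measurability

/-! ### Uniqueness of weak limits of laws on `M(E)`. -/

section Uniqueness

variable {E : Type*} [TopologicalSpace E] [MeasurableSpace E] [BorelSpace E]
  [HasOuterApproxClosed E]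

/-- The σ-algebra of `M(E)` is generated by the integrals of bounded continuous functions. -/
theorem measurableSpace_finiteMeasure_le_comap :
    (inferInstance : MeasurableSpace (FiniteMeasure E)) ≤
      MeasurableSpace.comap (fun (ν : FiniteMeasure E) (g : E →ᵇ ℝ≥0) => ν.testAgainstNN g)
        MeasurableSpace.pi := by
  set m : MeasurableSpace (FiniteMeasure E) := MeasurableSpace.comap
    (fun (ν : FiniteMeasure E) (g : E →ᵇ ℝ≥0) => ν.testAgainstNN g) MeasurableSpace.pi
  have hg : ∀ g : E →ᵇ ℝ≥0,
      Measurable[m] fun ν : FiniteMeasure E => ∫⁻ x, (g x : ℝ≥0∞) ∂(ν : Measure E) := by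
    intro g
    have h : Measurable[m] fun ν : FiniteMeasure E => ν.testAgainstNN g :=
      (measurable_pi_apply g).comp
        (comap_measurable fun (ν : FiniteMeasure E) (g : E →ᵇ ℝ≥0) => ν.testAgainstNN g)
    have := h.coe_nnreal_ennreal
    simpa only [FiniteMeasure.testAgainstNN_coe_eq] using this
  have hgen : ‹MeasurableSpace E› = MeasurableSpace.generateFrom {s : Set E | IsClosed s} :=
    BorelSpace.measurable_eq.trans borel_eq_generateFrom_isClosed
  have hcoe : ∀ s, MeasurableSet s →
      Measurable[m] fun ν : FiniteMeasure E => (ν : Measure E) s := by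
    intro s hs
    induction s, hs using MeasurableSpace.induction_on_inter hgen isPiSystem_isClosed with
    | empty => simp
    | basic t ht =>
      have ht' : IsClosed t := ht
      exact measurable_of_tendsto_metrizable (fun n => hg (ht'.apprSeq n))
        (tendsto_pi_nhds.2 fun μ => HasOuterApproxClosed.tendsto_lintegral_apprSeq ht' μ)
    | compl t ht ih =>
      have hu : Measurable[m] fun ν : FiniteMeasure E => (ν : Measure E) univ := by
        simpa using hg 1
      simp_rw [fun ν : FiniteMeasure E => measure_compl ht (measure_ne_top (ν : Measure E) t)]
      exact hu.sub ih
    | iUnion f hd hf ih =>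
      simp_rw [fun ν : FiniteMeasure E => measure_iUnion (μ := (ν : Measure E)) hd hf]
      exact Measurable.tsum ih
  intro s hs
  exact @measurable_finiteMeasure_of_measurable_coe E _ _ m id hcoe s hs

/-- Weak limits in the space of probability measures on `M(E)` are unique. -/
instance instT2SpaceProbabilityMeasureFiniteMeasure [OpensMeasurableSpace (FiniteMeasure E)] :
    T2Space (ProbabilityMeasure (FiniteMeasure E)) := by
  -- In an R1 space it is enough that topologically inseparable laws coincide; such laws integrate
  -- all bounded continuous functions alike.
  refine R1Space.t2Space_iff_t0Space.2 ⟨fun P R hPR => ?_⟩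
  have hint : ∀ F : FiniteMeasure E →ᵇ ℝ, ∫ ν, F ν ∂(P : Measure (FiniteMeasure E)) =
      ∫ ν, F ν ∂(R : Measure (FiniteMeasure E)) := by
    intro F
    have hc := (ProbabilityMeasure.tendsto_iff_forall_integral_tendsto.1
      (tendsto_id (α := ProbabilityMeasure (FiniteMeasure E)) (x := 𝓝 R))) F
    have h1 : pure P ≤ 𝓝 R := specializes_iff_pure.1 hPR.specializes
    exact tendsto_nhds_unique (tendsto_pure_nhds _ P) (hc.mono_left h1)
  set Ψ : FiniteMeasure E → (E →ᵇ ℝ≥0) → ℝ≥0 := fun ν g => ν.testAgainstNN g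
  have hΨm : Measurable Ψ := measurable_pi_lambda _ fun g =>
    (FiniteMeasure.continuous_testAgainstNN_eval g).measurable
  have hmap : (P : Measure (FiniteMeasure E)).map Ψ = (R : Measure (FiniteMeasure E)).map Ψ := by
    -- A law on the product over all test functions is determined by its finite-dimensional
    -- marginals. These live on finite powers of `ℝ≥0`, where bounded continuous functions separate
    -- finite measures.
    refine IsProjectiveLimit.unique
      (P := fun I => ((R : Measure (FiniteMeasure E)).map Ψ).map I.restrict)
      (fun I => ?_) fun I => rfl
    have hr : Measurable (I.restrict (π := fun _ : E →ᵇ ℝ≥0 => ℝ≥0)) := by fun_prop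
    dsimp only
    rw [Measure.map_map hr hΨm, Measure.map_map hr hΨm]
    have hc : Continuous (I.restrict (π := fun _ : E →ᵇ ℝ≥0 => ℝ≥0) ∘ Ψ) :=
      continuous_pi fun g => FiniteMeasure.continuous_testAgainstNN_eval g.1
    have := Measure.isProbabilityMeasure_map (μ := (P : Measure (FiniteMeasure E)))
      (hr.comp hΨm).aemeasurable
    have := Measure.isProbabilityMeasure_map (μ := (R : Measure (FiniteMeasure E)))
      (hr.comp hΨm).aemeasurable
    refine ext_of_forall_integral_eq_of_IsFiniteMeasure fun G => ?_
    rw [integral_map (hr.comp hΨm).aemeasurable G.continuous.aestronglyMeasurable,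
      integral_map (hr.comp hΨm).aemeasurable G.continuous.aestronglyMeasurable]
    exact hint (G.compContinuous ⟨_, hc⟩)
  refine Subtype.ext (Measure.ext fun s hs => ?_)
  obtain ⟨t, ht, rfl⟩ := measurableSpace_finiteMeasure_le_comap s hs
  have h : (P : Measure (FiniteMeasure E)).map Ψ t = (R : Measure (FiniteMeasure E)).map Ψ t := by
    rw [hmap]
  rwa [Measure.map_apply hΨm ht, Measure.map_apply hΨm ht] at h

end Uniqueness

/-! ### Series of independent random measures. -/

section RandomSeries

variable {E : Type*} [MeasurableSpace E]

open Classical in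
/-- The sum of a sequence of finite measures, as a finite measure (`0` if the sum is infinite). -/
noncomputable def finiteMeasureSum (ω : ℕ → FiniteMeasure E) : FiniteMeasure E :=
  if h : IsFiniteMeasure (Measure.sum fun i => (ω i : Measure E)) then ⟨_, h⟩ else 0

theorem finiteMeasureSum_coe {ω : ℕ → FiniteMeasure E}
    (h : ∑' i, (ω i : Measure E) univ < ∞) :
    (finiteMeasureSum ω : Measure E) = Measure.sum fun i => (ω i : Measure E) := by
  have h' : IsFiniteMeasure (Measure.sum fun i => (ω i : Measure E)) :=
    ⟨by rwa [Measure.sum_apply _ MeasurableSet.univ]⟩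
  simp [finiteMeasureSum, h']

theorem measurable_finiteMeasureSum :
    Measurable (finiteMeasureSum : (ℕ → FiniteMeasure E) → FiniteMeasure E) := by
  have hsum : ∀ s : Set E, MeasurableSet s →
      Measurable fun ω : ℕ → FiniteMeasure E => ∑' i, (ω i : Measure E) s := fun s hs =>
    Measurable.tsum fun i => (measurable_finiteMeasure_coe hs).comp (measurable_pi_apply i)
  refine measurable_finiteMeasure_of_measurable_coe fun s hs => ?_
  have heq : (fun ω : ℕ → FiniteMeasure E => (finiteMeasureSum ω : Measure E) s) =
      {ω | ∑' i, (ω i : Measure E) univ < ∞}.indicator fun ω => ∑' i, (ω i : Measure E) s := by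
    ext ω
    by_cases h : ∑' i, (ω i : Measure E) univ < ∞
    · rw [indicator_of_mem (by exact h), finiteMeasureSum_coe h, Measure.sum_apply _ hs]
    · have h' : ¬ IsFiniteMeasure (Measure.sum fun i => (ω i : Measure E)) := fun hf =>
        h (by simpa [Measure.sum_apply _ MeasurableSet.univ] using hf.measure_univ_lt_top)
      rw [indicator_of_notMem (by exact h)]
      simp [finiteMeasureSum, h']
  rw [heq]
  exact (hsum s hs).indicator (measurableSet_lt (hsum _ MeasurableSet.univ) measurable_const)

/-- Stated for Borel rather than continuous `f`: partial sums of a series of measures converge more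
strongly than weakly, and the Laplace functional of the limit needs this. -/
theorem tendsto_integral_sum_range {ω : ℕ → FiniteMeasure E}
    (h : ∑' i, (ω i : Measure E) univ < ∞) {f : E → ℝ} (hf : f ∈ BddBorel E) :
    Tendsto (fun n => ∫ x, f x ∂((∑ i ∈ Finset.range n, ω i : FiniteMeasure E) : Measure E)) atTop
      (𝓝 (∫ x, f x ∂(finiteMeasureSum ω : Measure E))) := by
  have hint := integrable_of_mem_bddBorel hf (finiteMeasureSum ω : Measure E)
  rw [finiteMeasureSum_coe h] at hint ⊢
  have := (hasSum_integral_measure hint).tendsto_sum_nat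
  simpa only [FiniteMeasure.toMeasure_sum, integral_finsetSum_measure
    fun i _ => integrable_of_mem_bddBorel hf (ω i : Measure E)] using this

theorem tendsto_sum_range_finiteMeasureSum [TopologicalSpace E] [OpensMeasurableSpace E]
    {ω : ℕ → FiniteMeasure E} (h : ∑' i, (ω i : Measure E) univ < ∞) :
    Tendsto (fun n => ∑ i ∈ Finset.range n, ω i) atTop (𝓝 (finiteMeasureSum ω)) :=
  FiniteMeasure.tendsto_iff_forall_integral_tendsto.2 fun f =>
    tendsto_integral_sum_range h ⟨f.continuous.measurable, ‖f‖, f.norm_coe_le_norm⟩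

theorem map_sum_range_infinitePi (Y : ℕ → Measure (FiniteMeasure E))
    [∀ i, IsProbabilityMeasure (Y i)] (n : ℕ) :
    (Measure.infinitePi Y).map (fun ω => ∑ i ∈ Finset.range (n + 1), ω i) =
      ((Measure.infinitePi Y).map fun ω => ∑ i ∈ Finset.range n, ω i).conv (Y n) := by
  have hind := (iIndepFun_infinitePi (P := Y) (X := fun _ ν => ν)
    fun _ => measurable_id).indepFun_sum_range_succ (fun i => measurable_pi_apply i) n
  have hfun : ∀ m, (∑ i ∈ Finset.range m, fun ω : ℕ → FiniteMeasure E => ω i) =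
      fun ω => ∑ i ∈ Finset.range m, ω i := fun m => by
    ext ω : 1
    simp
  have h := hind.map_add_eq_map_conv_map (hfun n ▸ Finset.measurable_sum _
    fun i _ => measurable_pi_apply i) (measurable_pi_apply n)
  rwa [Measure.infinitePi_map_eval, ← Finset.sum_range_succ, hfun, hfun] at h

end RandomSeries

/-! ### Existence of the weak limit by coupling. -/

section WeakLimit

variable {E : Type*} [MeasurableSpace E]

/-- The sum of the first moments is the expected total mass of the series. -/
theorem ae_tsum_lt_top_infinitePi {Y : ℕ → Measure (FiniteMeasure E)}
    [∀ i, IsProbabilityMeasure (Y i)] (h : ∑' i, firstMoment (Y i) < ∞) :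
    ∀ᵐ ω ∂Measure.infinitePi Y, ∑' i, (ω i : Measure E) univ < ∞ := by
  have hm := measurable_finiteMeasure_coe (E := E) MeasurableSet.univ
  refine ae_lt_top (Measurable.tsum fun i => hm.comp (measurable_pi_apply i)) ?_
  rw [lintegral_tsum (f := fun i (ω : ℕ → FiniteMeasure E) => (ω i : Measure E) univ)
    fun i => (hm.comp (measurable_pi_apply i)).aemeasurable]
  have heq : ∀ i, ∫⁻ ω, (ω i : Measure E) univ ∂Measure.infinitePi Y = firstMoment (Y i) :=
    fun i => by
      rw [firstMoment, ← Measure.infinitePi_map_eval (μ := Y) i,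
        lintegral_map hm (measurable_pi_apply i)]
  simpa only [heq] using h.ne

variable [TopologicalSpace E] [OpensMeasurableSpace E] [OpensMeasurableSpace (FiniteMeasure E)]

/-- A family of laws on `M(E)` that increases in the sense of convolution, with bounded first
moments, converges weakly; its Laplace functionals converge on all bounded Borel functions. -/
theorem exists_tendsto_of_conv_of_firstMoment_le {N : ℝ → ProbabilityMeasure (FiniteMeasure E)}
    (hconv : ∀ s t, 0 ≤ s → s ≤ t → ∃ M : ProbabilityMeasure (FiniteMeasure E),
      (N t : Measure (FiniteMeasure E)) = (M : Measure (FiniteMeasure E)).conv (N s))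
    {C : ℝ≥0∞} (hC : C ≠ ∞) (hNC : ∀ t, 0 ≤ t → firstMoment (N t : Measure (FiniteMeasure E)) ≤ C) :
    ∃ P : ProbabilityMeasure (FiniteMeasure E), Tendsto N atTop (𝓝 P) ∧
      ∀ f ∈ BddBorelPos E,
        Tendsto (fun n : ℕ => laplaceFunctional (N n : Measure (FiniteMeasure E)) f) atTop
          (𝓝 (laplaceFunctional (P : Measure (FiniteMeasure E)) f)) := by
  have : Nonempty (ProbabilityMeasure (FiniteMeasure E)) := ⟨N 0⟩
  choose! M hM using hconv
  set m : ℝ → ℝ≥0∞ := fun t => firstMoment (N t : Measure (FiniteMeasure E)) with hmdef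
  have hm : ∀ s t, 0 ≤ s → s ≤ t →
      firstMoment (M s t : Measure (FiniteMeasure E)) + m s = m t := fun s t hs hst => by
    simp only [hmdef]
    rw [hM s t hs hst, firstMoment_conv]
  have hmono : Monotone fun n : ℕ => m n := fun a b hab => by
    simp only [← hm a b (Nat.cast_nonneg a) (Nat.cast_le.2 hab)]
    exact le_add_self
  have hlim := tendsto_atTop_iSup hmono
  set mInf := ⨆ n : ℕ, m n
  have hmInf : mInf ≠ ∞ := ne_top_of_le_ne_top hC (iSup_le fun n => hNC n (Nat.cast_nonneg n))
  have hle : ∀ t, 0 ≤ t → m t ≤ mInf := fun t ht => by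
    refine le_trans ?_ (le_iSup (fun n : ℕ => m n) ⌈t⌉₊)
    rw [← hm t ⌈t⌉₊ ht (Nat.le_ceil t)]
    exact le_add_self
  -- The summands are `N_0` followed by the increments from `n` to `n + 1`, so `N_n` is the law of
  -- the first `n + 1` terms.
  obtain ⟨Y, hYprob, hY0, hYs⟩ : ∃ Y : ℕ → Measure (FiniteMeasure E),
      (∀ i, IsProbabilityMeasure (Y i)) ∧ Y 0 = N 0 ∧ ∀ n : ℕ, Y (n + 1) = M n (n + 1) := by
    refine ⟨fun i => Nat.casesOn i (N 0 : Measure (FiniteMeasure E))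
      fun n => (M n (n + 1) : Measure (FiniteMeasure E)), ?_, rfl, fun _ => rfl⟩
    rintro (_ | n)
    exacts [(N 0).2, (M n (n + 1)).2]
  have hYN : ∀ n : ℕ, (N (n + 1 : ℕ) : Measure (FiniteMeasure E)) =
      (N n : Measure (FiniteMeasure E)).conv (Y (n + 1)) := fun n => by
    rw [Measure.conv_comm, hYs]
    push_cast
    exact hM n (n + 1) (Nat.cast_nonneg n) (by linarith)
  have hYm : ∀ n : ℕ, ∑ i ∈ Finset.range (n + 1),
      firstMoment (Y i) = m n := by
    intro n
    induction n with
    | zero => simp [hY0, hmdef]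
    | succ n ih => rw [Finset.sum_range_succ, ih]; simp only [hmdef]; rw [hYN, firstMoment_conv]
  set μ := Measure.infinitePi Y
  have hlaw : ∀ n : ℕ, μ.map (fun ω => ∑ i ∈ Finset.range (n + 1), ω i) =
      (N n : Measure (FiniteMeasure E)) := by
    intro n
    induction n with
    | zero =>
      rw [map_sum_range_infinitePi]
      simp [hY0]
    | succ n ih => rw [map_sum_range_infinitePi, ih, hYN]
  have hSm : ∀ n : ℕ, Measurable fun ω : ℕ → FiniteMeasure E => ∑ i ∈ Finset.range n, ω i :=
    fun n => Finset.measurable_fun_sum _ fun i _ => measurable_pi_apply i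
  have hae : ∀ᵐ ω ∂μ, ∑' i, (ω i : Measure E) univ < ∞ := by
    refine ae_tsum_lt_top_infinitePi (lt_of_le_of_lt ?_ hC.lt_top)
    refine ENNReal.tsum_le_of_sum_range_le fun n => ?_
    refine le_trans ?_ ((hYm n).trans_le (hNC n (Nat.cast_nonneg n)))
    exact Finset.sum_le_sum_of_subset (Finset.range_subset_range.2 n.le_succ)
  have hPS : IsProbabilityMeasure (μ.map finiteMeasureSum) :=
    Measure.isProbabilityMeasure_map measurable_finiteMeasureSum.aemeasurable
  refine ⟨⟨μ.map finiteMeasureSum, hPS⟩, tendsto_of_subseq_tendsto fun u hu => ?_, fun f hf => ?_⟩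
  -- The increment from `⌊t⌋` to `t` has mean mass `m t - m ⌊t⌋ ≤ mInf - m ⌊t⌋`, which tends to
  -- zero.
  · have hρ : Tendsto (fun k => firstMoment (M ⌊u k⌋₊ (u k) : Measure (FiniteMeasure E))) atTop
        (𝓝 0) := by
      have h1 : Tendsto (fun k => mInf - m ⌊u k⌋₊) atTop (𝓝 0) := by
        simpa using ENNReal.Tendsto.sub (tendsto_const_nhds (x := mInf))
          (hlim.comp (tendsto_nat_floor_atTop.comp hu)) (Or.inl hmInf)
      refine tendsto_of_tendsto_of_tendsto_of_le_of_le' tendsto_const_nhds h1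
        (Eventually.of_forall fun _ => zero_le) ?_
      filter_upwards [hu.eventually_ge_atTop 0] with k hk
      have h2 := hm ⌊u k⌋₊ (u k) (Nat.cast_nonneg _) (Nat.floor_le hk)
      exact ENNReal.le_sub_of_add_le_right
        (ne_top_of_le_ne_top hmInf (hle _ (Nat.cast_nonneg _))) (h2.trans_le (hle _ hk))
    -- Geometric bounds make the mean masses summable along the subsequence, so the remainders tend
    -- to zero almost surely.
    obtain ⟨φ, hφ, hφu⟩ := extraction_forall_of_eventually
      (P := fun j k => firstMoment (M ⌊u k⌋₊ (u k) : Measure (FiniteMeasure E)) ≤ 2⁻¹ ^ j ∧ 0 ≤ u k)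
      fun j => (hρ.eventually_le_const (ENNReal.pow_pos (by simp) j)).and
        (hu.eventually_ge_atTop 0)
    refine ⟨φ, ?_⟩
    set R : ℕ → Measure (FiniteMeasure E) := fun j => M ⌊u (φ j)⌋₊ (u (φ j))
    have hR : ∀ᵐ ω ∂Measure.infinitePi R, ∑' i, (ω i : Measure E) univ < ∞ := by
      refine ae_tsum_lt_top_infinitePi (lt_of_le_of_lt
        (ENNReal.tsum_le_tsum fun j => (hφu j).1) ?_)
      simp [ENNReal.tsum_geometric, ENNReal.one_sub_inv_two]
    set n : ℕ → ℕ := fun j => ⌊u (φ j)⌋₊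
    have hn : Tendsto (fun j => n j + 1) atTop atTop :=
      (tendsto_add_atTop_nat 1).comp
        (tendsto_nat_floor_atTop.comp (hu.comp hφ.tendsto_atTop))
    -- The remainder is drawn independently of the series. Only the law of each single `Z j` must
    -- match `N (u (φ j))`; the joint law of the remainders is free and is taken to be a product.
    set Z : ℕ → (ℕ → FiniteMeasure E) × (ℕ → FiniteMeasure E) → FiniteMeasure E :=
      fun j p => p.1 j + ∑ i ∈ Finset.range (n j + 1), p.2 i
    have hZm : ∀ j, Measurable (Z j) := fun j =>
      ((measurable_pi_apply j).comp measurable_fst).add ((hSm (n j + 1)).comp measurable_snd)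
    have hZlaw : ∀ j, ((Measure.infinitePi R).prod μ).map (Z j) =
        (N (u (φ j)) : Measure (FiniteMeasure E)) := by
      intro j
      have hpm : Measurable (Prod.map (fun ω : ℕ → FiniteMeasure E => ω j)
          fun ω : ℕ → FiniteMeasure E => ∑ i ∈ Finset.range (n j + 1), ω i) :=
        Measurable.prodMap (measurable_pi_apply j) (hSm (n j + 1))
      rw [hM (n j) (u (φ j)) (Nat.cast_nonneg _) (Nat.floor_le (hφu j).2), ← hlaw (n j),
        Measure.conv]
      change _ = (Measure.map _ ((R j).prod _))
      rw [← Measure.infinitePi_map_eval (μ := R) j,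
        Measure.map_prod_map _ _ (measurable_pi_apply j) (hSm (n j + 1)),
        Measure.map_map measurable_add hpm]
      rfl
    have hZlim : ∀ᵐ p ∂(Measure.infinitePi R).prod μ,
        Tendsto (fun j => Z j p) atTop (𝓝 (finiteMeasureSum p.2)) := by
      filter_upwards [Measure.quasiMeasurePreserving_fst.ae hR,
        Measure.quasiMeasurePreserving_snd.ae hae] with p hp1 hp2
      have h1 : Tendsto p.1 atTop (𝓝 0) := by
        refine FiniteMeasure.tendsto_zero_of_tendsto_zero_mass ?_
        rw [← ENNReal.tendsto_coe]
        simpa using ENNReal.tendsto_atTop_zero_of_tsum_ne_top hp1.ne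
      have h2 := (tendsto_sum_range_finiteMeasureSum hp2).comp hn
      simpa [Z] using h1.add h2
    have hdist := (tendstoInDistribution_of_ae_tendsto (fun j => (hZm j).aemeasurable)
      (measurable_finiteMeasureSum.comp measurable_snd).aemeasurable hZlim).tendsto
    have hSlaw : ((Measure.infinitePi R).prod μ).map (finiteMeasureSum ∘ Prod.snd) =
        μ.map finiteMeasureSum := by
      rw [← Measure.map_map measurable_finiteMeasureSum measurable_snd, ← Measure.snd,
        Measure.snd_prod]
    have hN : ∀ j, N (u (φ j)) = ⟨_, Measure.isProbabilityMeasure_map (hZm j).aemeasurable⟩ :=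
      fun j => Subtype.ext (hZlaw j).symm
    simp only [hN, ← hSlaw]
    exact hdist
  · have hfm := measurable_integral_finiteMeasure hf.1.1
    have hexp : Measurable fun ν : FiniteMeasure E =>
        Real.exp (-∫ x, f x ∂(ν : Measure E)) := hfm.neg.exp
    have hLN : ∀ n : ℕ, laplaceFunctional (N n : Measure (FiniteMeasure E)) f =
        ∫ ω, Real.exp (-∫ x, f x
          ∂((∑ i ∈ Finset.range (n + 1), ω i : FiniteMeasure E) : Measure E)) ∂μ := fun n => by
      rw [laplaceFunctional, ← hlaw n,
        integral_map (hSm _).aemeasurable hexp.aestronglyMeasurable]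
    have hLS : laplaceFunctional (μ.map finiteMeasureSum) f =
        ∫ ω, Real.exp (-∫ x, f x ∂(finiteMeasureSum ω : Measure E)) ∂μ := by
      rw [laplaceFunctional, integral_map measurable_finiteMeasureSum.aemeasurable
        hexp.aestronglyMeasurable]
    simp only [hLN, ProbabilityMeasure.coe_mk, hLS]
    -- At integer times there is no remainder, and almost sure convergence of `ν(f)` along the
    -- partial sums suffices.
    refine tendsto_integral_of_dominated_convergence (fun _ => (1 : ℝ))
      (fun n => (hexp.comp (hSm _)).aestronglyMeasurable) (integrable_const _)
      (fun n => Eventually.of_forall fun ω => ?_) ?_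
    · rw [Real.norm_eq_abs, Real.abs_exp, Real.exp_le_one_iff]
      exact neg_nonpos.2 (integral_nonneg hf.2)
    · filter_upwards [hae] with ω hω
      exact (((tendsto_integral_sum_range hω hf.1).comp (tendsto_add_atTop_nat 1)).neg).rexp

end WeakLimit

/-! ### Convolution increments, and weak convergence tested on constants. -/

section SkewConvolution

/-- The cofactor is `N_{t-s} Q_s`. -/
theorem IsSCSemigroup.exists_conv {E : Type*} [MeasurableSpace E]
    {Q : ℝ → Kernel (FiniteMeasure E) (FiniteMeasure E)}
    {N : ℝ → ProbabilityMeasure (FiniteMeasure E)} (hN : IsSCSemigroup Q N) (hQ : IsMBSemigroup Q)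
    {s t : ℝ} (hs : 0 ≤ s) (hst : s ≤ t) : ∃ M : ProbabilityMeasure (FiniteMeasure E),
      (N t : Measure (FiniteMeasure E)) = (M : Measure (FiniteMeasure E)).conv (N s) := by
  have := hQ.markov s hs
  refine ⟨⟨(N (t - s) : Measure (FiniteMeasure E)).bind (Q s), inferInstance⟩, ?_⟩
  have h := hN (t - s) s (sub_nonneg.2 hst) hs
  rwa [sub_add_cancel] at h

theorem tendsto_laplaceFunctional_const {E : Type*} [TopologicalSpace E] [MeasurableSpace E]
    [OpensMeasurableSpace E] [OpensMeasurableSpace (FiniteMeasure E)] {ι : Type*} {l : Filter ι}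
    {N : ι → ProbabilityMeasure (FiniteMeasure E)} {P : ProbabilityMeasure (FiniteMeasure E)}
    (h : Tendsto N l (𝓝 P)) {c : ℝ} (hc : 0 ≤ c) :
    Tendsto (fun i => laplaceFunctional (N i : Measure (FiniteMeasure E)) fun _ => c) l
      (𝓝 (laplaceFunctional (P : Measure (FiniteMeasure E)) fun _ => c)) := by
  have hcont : Continuous fun ν : FiniteMeasure E => Real.exp (-∫ _, c ∂(ν : Measure E)) :=
    (FiniteMeasure.continuous_integral_boundedContinuousFunction
      (BoundedContinuousFunction.const E c)).neg.rexp
  have hbd : ∀ ν : FiniteMeasure E, ‖Real.exp (-∫ _, c ∂(ν : Measure E))‖ ≤ 1 := fun ν => by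
    rw [Real.norm_eq_abs, Real.abs_exp, Real.exp_le_one_iff]
    exact neg_nonpos.2 (integral_nonneg fun _ => hc)
  exact ProbabilityMeasure.tendsto_iff_forall_integral_tendsto.1 h
    (BoundedContinuousFunction.ofNormedAddCommGroup _ hcont 1 hbd)

end SkewConvolution

/-! ### First moments of signed bounded Borel functions. -/

section SignedMoments

variable {E : Type*} [MeasurableSpace E] {P : Measure (FiniteMeasure E)}

theorem posPart_mem_bddBorelPos {f : E → ℝ} (hf : f ∈ BddBorel E) :
    (fun x => max (f x) 0) ∈ BddBorelPos E := by
  obtain ⟨hm, C, hC⟩ := hf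
  refine ⟨⟨hm.max measurable_const, C, fun x => ?_⟩, fun x => le_max_right _ _⟩
  rw [abs_of_nonneg (le_max_right _ _)]
  exact max_le ((le_abs_self _).trans (hC x)) ((abs_nonneg _).trans (hC x))

theorem neg_mem_bddBorel {f : E → ℝ} (hf : f ∈ BddBorel E) : (fun x => -f x) ∈ BddBorel E := by
  obtain ⟨hm, C, hC⟩ := hf
  exact ⟨hm.neg, C, fun x => by rw [abs_neg]; exact hC x⟩

theorem integral_eq_integral_posPart_sub {f : E → ℝ} (hf : f ∈ BddBorel E) (ν : Measure E)
    [IsFiniteMeasure ν] :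
    ∫ x, f x ∂ν = ∫ x, max (f x) 0 ∂ν - ∫ x, max (-f x) 0 ∂ν := by
  rw [← integral_sub (integrable_of_mem_bddBorel (posPart_mem_bddBorelPos hf).1 ν)
    (integrable_of_mem_bddBorel (posPart_mem_bddBorelPos (neg_mem_bddBorel hf)).1 ν)]
  congr 1 with x
  rcases le_total 0 (f x) with h | h
  · rw [max_eq_left h, max_eq_right (neg_nonpos.2 h), sub_zero]
  · rw [max_eq_right h, max_eq_left (neg_nonneg.2 h), zero_sub, neg_neg]

/-- Domination: `|ν(f)| ≤ C ν(1)`. -/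
theorem integrable_integral_of_firstMoment_lt_top (hP : firstMoment P < ∞) {f : E → ℝ}
    (hf : f ∈ BddBorel E) :
    Integrable (fun ν : FiniteMeasure E => ∫ x, f x ∂(ν : Measure E)) P := by
  obtain ⟨C, hC⟩ := hf.2
  have hmass : Integrable (fun ν : FiniteMeasure E => (ν : Measure E).real univ) P :=
    integrable_toReal_of_lintegral_ne_top
      (measurable_finiteMeasure_coe MeasurableSet.univ).aemeasurable hP.ne
  refine (hmass.const_mul C).mono'
    (measurable_integral_finiteMeasure hf.1).aestronglyMeasurable (Eventually.of_forall fun ν => ?_)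
  exact norm_integral_le_of_norm_le_const (Eventually.of_forall hC)

theorem lintegral_integral_ne_top_of_firstMoment_lt_top (hP : firstMoment P < ∞) {f : E → ℝ}
    (hf : f ∈ BddBorelPos E) :
    ∫⁻ ν : FiniteMeasure E, ENNReal.ofReal (∫ x, f x ∂(ν : Measure E)) ∂P ≠ ∞ :=
  (integrable_integral_of_firstMoment_lt_top hP hf.1).lintegral_lt_top.ne

theorem integral_integral_eq_toReal {f : E → ℝ} (hf : f ∈ BddBorelPos E) :
    ∫ ν : FiniteMeasure E, (∫ x, f x ∂(ν : Measure E)) ∂P =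
      (∫⁻ ν : FiniteMeasure E, ENNReal.ofReal (∫ x, f x ∂(ν : Measure E)) ∂P).toReal :=
  integral_eq_lintegral_of_nonneg_ae (Eventually.of_forall fun _ => integral_nonneg hf.2)
    (measurable_integral_finiteMeasure hf.1.1).aestronglyMeasurable

/-- The first moment formula for nonnegative functions extends to all bounded Borel functions. -/
theorem integrableOn_and_integral_eq_of_lintegral_eq
    {K : ℝ → ProbabilityMeasure (FiniteMeasure E)} {A : Set ℝ}
    (hK : ∀ f ∈ BddBorelPos E, AEMeasurable (fun s => logLaplace K s f) (volume.restrict A))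
    (hP : firstMoment P < ∞)
    (hKP : ∀ f ∈ BddBorelPos E,
      ∫⁻ ν : FiniteMeasure E, ENNReal.ofReal (∫ x, f x ∂(ν : Measure E)) ∂P =
        ∫⁻ s in A, ∫⁻ ν : FiniteMeasure E, ENNReal.ofReal (∫ x, f x ∂(ν : Measure E))
          ∂(K s : Measure (FiniteMeasure E)))
    {f : E → ℝ} (hf : f ∈ BddBorel E) :
    (∀ᵐ s ∂(volume.restrict A), Integrable (fun ν : FiniteMeasure E => ∫ x, f x ∂(ν : Measure E))
        (K s : Measure (FiniteMeasure E))) ∧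
      IntegrableOn (fun s => ∫ ν : FiniteMeasure E, (∫ x, f x ∂(ν : Measure E))
        ∂(K s : Measure (FiniteMeasure E))) A ∧
      ∫ ν : FiniteMeasure E, (∫ x, f x ∂(ν : Measure E)) ∂P =
        ∫ s in A, ∫ ν : FiniteMeasure E, (∫ x, f x ∂(ν : Measure E))
          ∂(K s : Measure (FiniteMeasure E)) := by
  have hfin : ∀ g ∈ BddBorelPos E, ∫⁻ s in A, ∫⁻ ν : FiniteMeasure E,
      ENNReal.ofReal (∫ x, g x ∂(ν : Measure E)) ∂(K s : Measure (FiniteMeasure E)) ≠ ∞ :=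
    fun g hg => hKP g hg ▸ lintegral_integral_ne_top_of_firstMoment_lt_top hP hg
  -- The identity at `f = 1` makes the moments of `K s` finite for almost every `s`; there the
  -- splitting into positive and negative parts is legitimate.
  have hae : ∀ᵐ s ∂(volume.restrict A), firstMoment (K s : Measure (FiniteMeasure E)) < ∞ := by
    have h1 := const_mem_bddBorelPos (E := E) zero_le_one
    simp only [firstMoment_eq_lintegral_ofReal]
    exact ae_lt_top' (aemeasurable_lintegral_integral hK h1) (hfin _ h1)
  have hpos : ∀ g ∈ BddBorelPos E,
      IntegrableOn (fun s => ∫ ν : FiniteMeasure E, (∫ x, g x ∂(ν : Measure E))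
        ∂(K s : Measure (FiniteMeasure E))) A ∧
      ∫ ν : FiniteMeasure E, (∫ x, g x ∂(ν : Measure E)) ∂P =
        ∫ s in A, ∫ ν : FiniteMeasure E, (∫ x, g x ∂(ν : Measure E))
          ∂(K s : Measure (FiniteMeasure E)) := by
    intro g hg
    have hgm := aemeasurable_lintegral_integral hK hg
    simp only [integral_integral_eq_toReal hg]
    refine ⟨integrable_toReal_of_lintegral_ne_top hgm (hfin g hg), ?_⟩
    rw [integral_toReal hgm (ae_lt_top' hgm (hfin g hg)), hKP g hg]
  have hf1 := posPart_mem_bddBorelPos hf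
  have hf2 := posPart_mem_bddBorelPos (neg_mem_bddBorel hf)
  have hsub : ∀ ρ : Measure (FiniteMeasure E), firstMoment ρ < ∞ →
      ∫ ν : FiniteMeasure E, (∫ x, f x ∂(ν : Measure E)) ∂ρ =
        ∫ ν : FiniteMeasure E, (∫ x, max (f x) 0 ∂(ν : Measure E)) ∂ρ -
          ∫ ν : FiniteMeasure E, (∫ x, max (-f x) 0 ∂(ν : Measure E)) ∂ρ := fun ρ hρ => by
    simp only [fun ν : FiniteMeasure E => integral_eq_integral_posPart_sub hf (ν : Measure E)]
    exact integral_sub (integrable_integral_of_firstMoment_lt_top hρ hf1.1)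
      (integrable_integral_of_firstMoment_lt_top hρ hf2.1)
  have hsubK := hae.mono fun s hs => hsub (K s) hs
  refine ⟨hae.mono fun s hs => integrable_integral_of_firstMoment_lt_top hs hf, ?_, ?_⟩
  · exact ((hpos _ hf1).1.sub (hpos _ hf2).1).congr (hsubK.mono fun s hs => hs.symm)
  · rw [integral_congr_ae hsubK, integral_sub (hpos _ hf1).1 (hpos _ hf2).1, hsub P hP,
      (hpos _ hf1).2, (hpos _ hf2).2]

end SignedMoments

/-! ### The equivalence and the formulas for the limit. -/

theorem theorem4p5 {E : Type*} [TopologicalSpace E] [LusinSpace E] [MeasurableSpace E]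
    [BorelSpace E] (Q : ℝ → Kernel (FiniteMeasure E) (FiniteMeasure E)) (hQ : IsMBSemigroup Q)
    (N K : ℝ → ProbabilityMeasure (FiniteMeasure E)) (hN : IsSCSemigroup Q N)
    (hK : IsInfDivisibleEntranceLaw Q K) (hNK : IsGivenByEntranceLaw N K) :
    -- convergence to a limit with finite first moment, if and only if the moment condition holds
    ((∃ Ninf : ProbabilityMeasure (FiniteMeasure E), Tendsto N atTop (𝓝 Ninf) ∧
        firstMoment (Ninf : Measure (FiniteMeasure E)) < ∞) ↔
      ∫⁻ s in Ioi (0 : ℝ), firstMoment (K s : Measure (FiniteMeasure E)) < ∞) ∧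
    -- in this case, the Laplace functional and the first moments of the limit
    (∀ Ninf : ProbabilityMeasure (FiniteMeasure E), Tendsto N atTop (𝓝 Ninf) →
      firstMoment (Ninf : Measure (FiniteMeasure E)) < ∞ →
      (∀ f ∈ BddBorelPos E,
        IntegrableOn (fun s => logLaplace K s f) (Ioi (0 : ℝ)) ∧
        laplaceFunctional (Ninf : Measure (FiniteMeasure E)) f =
          Real.exp (-∫ s in Ioi (0 : ℝ), logLaplace K s f)) ∧
      (∀ f ∈ BddBorel E,
        Integrable (fun ν : FiniteMeasure E => ∫ x, f x ∂(ν : Measure E))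
          (Ninf : Measure (FiniteMeasure E)) ∧
        (∀ᵐ s ∂(volume.restrict (Ioi (0 : ℝ))),
          Integrable (fun ν : FiniteMeasure E => ∫ x, f x ∂(ν : Measure E))
            (K s : Measure (FiniteMeasure E))) ∧
        IntegrableOn (fun s => ∫ ν : FiniteMeasure E, (∫ x, f x ∂(ν : Measure E))
          ∂(K s : Measure (FiniteMeasure E))) (Ioi (0 : ℝ)) ∧
        ∫ ν in {ν : FiniteMeasure E | ν ≠ 0}, (∫ x, f x ∂(ν : Measure E))
            ∂(Ninf : Measure (FiniteMeasure E)) =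
          ∫ s in Ioi (0 : ℝ), ∫ ν : FiniteMeasure E, (∫ x, f x ∂(ν : Measure E))
            ∂(K s : Measure (FiniteMeasure E)))) := by

  obtain ⟨K₀, _, _, _, φ, hφ, -⟩ := LusinSpace.exists_embedding (E := E)
  have : TopologicalSpace.MetrizableSpace E := hφ.metrizableSpace
  have h1 := const_mem_bddBorelPos (E := E) zero_le_one
  have hlimit : ∀ (P : ProbabilityMeasure (FiniteMeasure E)), Tendsto N atTop (𝓝 P) →
      firstMoment (P : Measure (FiniteMeasure E)) =
        ∫⁻ s in Ioi (0 : ℝ), firstMoment (K s : Measure (FiniteMeasure E)) := by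
    intro P hP
    simp only [firstMoment_eq_lintegral_ofReal]
    refine lintegral_integral_eq_of_neg_log_laplaceFunctional_eq hNK.measurable h1 fun c hc =>
      hNK.ofReal_neg_log_laplaceFunctional_of_tendsto (const_mul_mem_bddBorelPos h1 hc) ?_
    exact (tendsto_laplaceFunctional_const hP (mul_nonneg hc zero_le_one)).comp
      tendsto_natCast_atTop_atTop
  have hexists : ∫⁻ s in Ioi (0 : ℝ), firstMoment (K s : Measure (FiniteMeasure E)) < ∞ →
      ∃ P : ProbabilityMeasure (FiniteMeasure E), Tendsto N atTop (𝓝 P) ∧ ∀ f ∈ BddBorelPos E,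
        Tendsto (fun n : ℕ => laplaceFunctional (N n : Measure (FiniteMeasure E)) f) atTop
          (𝓝 (laplaceFunctional (P : Measure (FiniteMeasure E)) f)) := fun h =>
    exists_tendsto_of_conv_of_firstMoment_le (fun s t hs hst => hN.exists_conv hQ hs hst) h.ne
      fun t ht => (hNK.firstMoment_eq ht).trans_le (lintegral_mono_set Ioc_subset_Ioi_self)
  refine ⟨⟨fun ⟨P, hP, hPm⟩ => hlimit P hP ▸ hPm, fun h => ?_⟩, fun Ninf hNinf hm => ?_⟩
  · obtain ⟨P, hP, -⟩ := hexists h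
    exact ⟨P, hP, (hlimit P hP).trans_lt h⟩
  -- The given limit is identified with the coupled one in order to inherit convergence of Laplace
  -- functionals at Borel `f`.
  obtain ⟨P, hP, hPL⟩ := hexists (hlimit Ninf hNinf ▸ hm)
  obtain rfl := tendsto_nhds_unique hP hNinf
  have hlog : ∀ f ∈ BddBorelPos E,
      ENNReal.ofReal (-Real.log (laplaceFunctional (P : Measure (FiniteMeasure E)) f)) =
        ∫⁻ s in Ioi 0, ENNReal.ofReal (logLaplace K s f) := fun f hf =>
    hNK.ofReal_neg_log_laplaceFunctional_of_tendsto hf (hPL f hf)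
  refine ⟨fun f hf => ?_, fun f hf => ?_⟩
  · have hnn : 0 ≤ᵐ[volume.restrict (Ioi (0 : ℝ))] fun s => logLaplace K s f :=
      Eventually.of_forall fun s => logLaplace_nonneg s hf
    have hms := (hNK.measurable f hf).aestronglyMeasurable
    refine ⟨(lintegral_ofReal_ne_top_iff_integrable hms hnn).1
      (hlog f hf ▸ ENNReal.ofReal_ne_top), ?_⟩
    rw [integral_eq_lintegral_of_nonneg_ae hnn hms, ← hlog f hf,
      ENNReal.toReal_ofReal (neg_log_laplaceFunctional_nonneg hf), neg_neg,
      Real.exp_log (laplaceFunctional_pos hf)]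
  · obtain ⟨hi, hion, heq⟩ := integrableOn_and_integral_eq_of_lintegral_eq hNK.measurable hm
      (fun g hg => lintegral_integral_eq_of_neg_log_laplaceFunctional_eq hNK.measurable hg
        fun c hc => hlog _ (const_mul_mem_bddBorelPos hg hc)) hf
    refine ⟨integrable_integral_of_firstMoment_lt_top hm hf, hi, hion, ?_⟩
    rw [← heq]
    -- Removing the zero measure changes nothing, as `ν(f) = 0` there.
    refine setIntegral_eq_integral_of_forall_compl_eq_zero fun ν hν => ?_
    obtain rfl : ν = 0 := by simpa using hν
    simp
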